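/- All matrices have integer entries. Two matrices $X,Y$ of the same order are amicable if $XY^\top=YX^\top$. Symmetric Williamson-type matrices of order $n$ are four symmetric, pairwise amicable $\pm1$ matrices $W_1,\dots,W_4$ of order $n$ with $\sum_{k}W_kW_k^\top=4nI_n$. Propus-type matrices of order $n$ are pairwise amicable $\pm1$ matrices $A,B,B,D$ of order $n$ with $A^\top=A$ and $AA^\top+2BB^\top+DD^\top=4nI_n$. A symmetric propus-type Hadamard matrix of order $4n$ is a symmetric Hadamard matrix of the form $$\begin{bmatrix}A&B&B&D\\B&D&-A&-B\\B&-A&-D&B\\D&-B&B&-A\end{bmatrix}$$ with $A,B,B,D$ propus-type matrices of order $n$. A symmetric conference matrix of order $m$ is a symmetric matrix $C$ with zero diagonal, off-diagonal entries $\pm1$ and $CC^\top=(m-1)I_m$; a matrix $Q$ of order $n$ is the core of a symmetric conference matrix if $\begin{bmatrix}0&e\\e^\top&Q\end{bmatrix}$ is a symmetric conference matrix of order $n+1$, where $e$ is the all-ones row. **Corollary.** Let $q\equiv1\pmod 4$ be a prime power such that $\tfrac12(q+1)$ is either a prime power or the order of the core of a symmetric conference matrix. Then there exist symmetric Williamson-type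 matrices of order $q+2$ and a symmetric propus-type Hadamard matrix of order $4(q+2)$. The second alternative occurs for $q=89$: there is a core of a symmetric conference matrix of order $45$. In particular, symmetric propus-type Hadamard matrices of orders $4\cdot 11$ and $4\cdot 83$ exist. -/

import Mathlib

open Matrix

namespace Propus

/-- All entries of the matrix are `1` or `-1`. -/
def IsSignMatrix {n : ℕ} (A : Matrix (Fin n) (Fin n) ℤ) : Prop :=
  ∀ i j, A i j = 1 ∨ A i j = -1

/-- Two matrices `X`, `Y` of the same order are amicable if `X Yᵀ = Y Xᵀ`. -/
def Amicable {n : ℕ} (X Y : Matrix (Fin n) (Fin n) ℤ) : Prop :=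
  X * Yᵀ = Y * Xᵀ

/-- Symmetric Williamson-type matrices of order `n`: four symmetric, pairwise amicable
`±1` matrices `W 0, W 1, W 2, W 3` of order `n` with `∑ W k (W k)ᵀ = 4 n I`. -/
structure IsSymmetricWilliamsonType {n : ℕ} (W : Fin 4 → Matrix (Fin n) (Fin n) ℤ) : Prop where
  sign : ∀ k, IsSignMatrix (W k)
  symm : ∀ k, (W k).IsSymm
  amicable : ∀ k l, k ≠ l → Amicable (W k) (W l)
  additive : ∑ k, W k * (W k)ᵀ = (4 * (n : ℤ)) • (1 : Matrix (Fin n) (Fin n) ℤ)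

/-- Propus-type matrices `A, B, B, D` of order `n`: pairwise amicable `±1` matrices with
`Aᵀ = A` and the additive property `A Aᵀ + 2 B Bᵀ + D Dᵀ = 4 n I`. -/
structure IsPropusType {n : ℕ} (A B D : Matrix (Fin n) (Fin n) ℤ) : Prop where
  sign_A : IsSignMatrix A
  sign_B : IsSignMatrix B
  sign_D : IsSignMatrix D
  symm_A : A.IsSymm
  amicable_AB : Amicable A B
  amicable_AD : Amicable A D
  amicable_BD : Amicable B D
  additive : A * Aᵀ + (2 : ℤ) • (B * Bᵀ) + D * Dᵀ
    = (4 * (n : ℤ)) • (1 : Matrix (Fin n) (Fin n) ℤ)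

/-- The propus array: the `4 × 4` block matrix below, as a matrix of order `4 n`. -/
def propusArray {n : ℕ} (A B D : Matrix (Fin n) (Fin n) ℤ) :
    Matrix (Fin (4 * n)) (Fin (4 * n)) ℤ :=
  reindex finProdFinEquiv finProdFinEquiv
    (Matrix.comp (Fin 4) (Fin 4) (Fin n) (Fin n) ℤ
      !![A,  B,  B,  D;
         B,  D, -A, -B;
         B, -A, -D,  B;
         D, -B,  B, -A])

/-- A symmetric propus-type Hadamard matrix of order `4 n`: a symmetric Hadamard matrix obtained
by plugging propus-type matrices of order `n` into the propus array. -/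
def IsSymmetricPropusTypeHadamard {n : ℕ} (H : Matrix (Fin (4 * n)) (Fin (4 * n)) ℤ) : Prop :=
  (∃ A B D : Matrix (Fin n) (Fin n) ℤ, IsPropusType A B D ∧ H = propusArray A B D) ∧
    H.IsSymm ∧ H.IsHadamard

/-- A symmetric conference matrix of order `m = |ι|`: a symmetric matrix with zero diagonal and
off-diagonal entries `±1` such that `C Cᵀ = (m - 1) I`. -/
structure IsSymmetricConference {ι : Type*} [Fintype ι] [DecidableEq ι]
    (C : Matrix ι ι ℤ) : Prop where
  diag : ∀ i, C i i = 0
  off_diag : ∀ i j, i ≠ j → C i j = 1 ∨ C i j = -1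
  symm : C.IsSymm
  mul_transpose : C * Cᵀ = ((Fintype.card ι : ℤ) - 1) • (1 : Matrix ι ι ℤ)

/-- `Q`, of order `n`, is the core of a symmetric conference matrix (of order `n + 1`): bordering
it by a row and a column of ones, with corner entry `0`, gives a symmetric conference matrix. -/
def IsSymmetricConferenceCore {n : ℕ} (Q : Matrix (Fin n) (Fin n) ℤ) : Prop :=
  IsSymmetricConference
    (fromBlocks (0 : Matrix Unit Unit ℤ) (of fun _ _ => 1) (of fun _ _ => 1) Q)

end Propus

/-! Let `d` be a nonsquare in the field `F` with `q ≡ 1 [MOD 4]` elements and put `n = (q + 1) / 2`,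
which is odd. The nonzero elements of `F(√d)` are the `c g` and `c √d g` with `c ∈ Fˣ` and `g` an
`n`-th root of unity. Summing over them the product of the quadratic characters of two independent
linear forms, which gives zero, and using that the factors `c` do not contribute, one obtains
Turyn's theorem: the circulants `A` and `B` over the group of `n`-th roots of unity built from the
quadratic characters of the two coordinates satisfy `A² + B² = (2n - 1) I`.

Let `J` be the all-ones matrix, and let `P` be a symmetric matrix with `P² = n I - J` whose zeros
form a symmetric permutation matrix `R` commuting with `A` and `B`: for the core of a conference
matrix, `R = I`; for `n` a prime power, take `χ(x + y)`, with `χ` the quadratic character of a field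
with `n` elements, identified with the index group compatibly with negation, so that `R` is the
negation. In the basis of sums and differences, the pairs `(I, A)`, `(P, R)` and `(0, B)` give three
commuting symmetric sign matrices `X`, `Y`, `Z` of order `2n = q + 1`, for which
`X² + 2Y² + Z² = 4(2n + 1) I - 4J`, and a border of suitable signs cancels the term `4J`. -/

namespace Propus

section PropusMatrices

variable {ι κ : Type*} [Fintype ι] [DecidableEq ι] [Fintype κ] [DecidableEq κ]

/-- Symmetric propus matrices indexed by an arbitrary finite type: three commuting symmetric `±1`
matrices with the additive property of propus-type matrices. For symmetric matrices, commuting and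
being amicable are the same. -/
structure IsSymmetricPropus (A B D : Matrix ι ι ℤ) : Prop where
  sign_A : ∀ i j, A i j = 1 ∨ A i j = -1
  sign_B : ∀ i j, B i j = 1 ∨ B i j = -1
  sign_D : ∀ i j, D i j = 1 ∨ D i j = -1
  symm_A : A.IsSymm
  symm_B : B.IsSymm
  symm_D : D.IsSymm
  commute_AB : Commute A B
  commute_AD : Commute A D
  commute_BD : Commute B D
  additive : A * A + (2 : ℤ) • (B * B) + D * D = (4 * (Fintype.card ι : ℤ)) • (1 : Matrix ι ι ℤ)

theorem IsSymmetricPropus.submatrix {A B D : Matrix ι ι ℤ} (h : IsSymmetricPropus A B D)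
    (e : κ ≃ ι) : IsSymmetricPropus (A.submatrix e e) (B.submatrix e e) (D.submatrix e e) where
  sign_A _ _ := h.sign_A _ _
  sign_B _ _ := h.sign_B _ _
  sign_D _ _ := h.sign_D _ _
  symm_A := h.symm_A.submatrix e
  symm_B := h.symm_B.submatrix e
  symm_D := h.symm_D.submatrix e
  commute_AB := h.commute_AB.map (reindexRingEquiv ℤ e.symm)
  commute_AD := h.commute_AD.map (reindexRingEquiv ℤ e.symm)
  commute_BD := h.commute_BD.map (reindexRingEquiv ℤ e.symm)
  additive := by
    have image := congrArg (reindexRingEquiv ℤ e.symm) h.additive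
    simp only [map_add, map_mul, map_zsmul, map_one] at image
    rwa [Fintype.card_congr e]

theorem amicable_iff_commute {n : ℕ} {X Y : Matrix (Fin n) (Fin n) ℤ} (hX : X.IsSymm)
    (hY : Y.IsSymm) : Amicable X Y ↔ Commute X Y := by
  rw [Amicable, hX.eq, hY.eq, commute_iff_eq]

theorem IsSymmetricPropus.isPropusType {n : ℕ} {A B D : Matrix (Fin n) (Fin n) ℤ}
    (h : IsSymmetricPropus A B D) : IsPropusType A B D where
  sign_A := h.sign_A
  sign_B := h.sign_B
  sign_D := h.sign_D
  symm_A := h.symm_A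
  amicable_AB := (amicable_iff_commute h.symm_A h.symm_B).2 h.commute_AB
  amicable_AD := (amicable_iff_commute h.symm_A h.symm_D).2 h.commute_AD
  amicable_BD := (amicable_iff_commute h.symm_B h.symm_D).2 h.commute_BD
  additive := by
    simpa only [h.symm_A.eq, h.symm_B.eq, h.symm_D.eq, Fintype.card_fin] using h.additive

theorem IsSymmetricPropus.isSymmetricWilliamsonType {n : ℕ} {A B D : Matrix (Fin n) (Fin n) ℤ}
    (h : IsSymmetricPropus A B D) : IsSymmetricWilliamsonType ![A, B, B, D] := by
  have symm : ∀ k, (![A, B, B, D] k).IsSymm := by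
    intro k
    fin_cases k
    exacts [h.symm_A, h.symm_B, h.symm_B, h.symm_D]
  have commute : ∀ k l, Commute (![A, B, B, D] k) (![A, B, B, D] l) := by
    intro k l
    fin_cases k <;> fin_cases l
    exacts [.refl _, h.commute_AB, h.commute_AB, h.commute_AD,
      h.commute_AB.symm, .refl _, .refl _, h.commute_BD,
      h.commute_AB.symm, .refl _, .refl _, h.commute_BD,
      h.commute_AD.symm, h.commute_BD.symm, h.commute_BD.symm, .refl _]
  refine ⟨fun k => ?_, symm, fun k l _ => (amicable_iff_commute (symm k) (symm l)).2 (commute k l),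
    ?_⟩
  · fin_cases k
    exacts [h.sign_A, h.sign_B, h.sign_B, h.sign_D]
  · have additive := h.additive
    simp only [(symm _).eq, Fin.sum_univ_four, cons_val]
    rw [two_smul, ← add_assoc, Fintype.card_fin] at additive
    exact additive

/-- The `4 × 4` pattern of the propus array, with entries in an arbitrary ring. -/
def propusPattern {R : Type*} [Ring R] (a b d : R) : Matrix (Fin 4) (Fin 4) R :=
  !![a,  b,  b,  d;
     b,  d, -a, -b;
     b, -a, -d,  b;
     d, -b,  b, -a]

theorem propusPattern_mul_self {R : Type*} [Ring R] {a b d : R} (hab : Commute a b)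
    (had : Commute a d) (hbd : Commute b d) :
    propusPattern a b d * propusPattern a b d =
      scalar (Fin 4) (a * a + (2 : ℤ) • (b * b) + d * d) := by
  ext i j
  fin_cases i <;> fin_cases j <;>
    simp only [propusPattern, Matrix.mul_apply, Fin.sum_univ_four, of_apply, cons_val,
      Fin.zero_eta, Fin.mk_one, Fin.reduceFinMk, mul_neg, neg_mul, neg_neg, hab.eq, had.eq, hbd.eq,
      scalar_apply, diagonal_apply_eq, two_smul, ne_eq, Fin.reduceEq, not_false_eq_true,
      diagonal_apply_ne, zero_ne_one, one_ne_zero] <;>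
    abel

theorem propusArray_mul_self {n : ℕ} {A B D : Matrix (Fin n) (Fin n) ℤ}
    (h : IsSymmetricPropus A B D) :
    propusArray A B D * propusArray A B D = (4 * (n : ℤ)) • 1 := by
  let blocks : Matrix (Fin 4) (Fin 4) (Matrix (Fin n) (Fin n) ℤ) ≃+*
      Matrix (Fin (4 * n)) (Fin (4 * n)) ℤ :=
    (compRingEquiv (Fin 4) (Fin n) ℤ).trans (reindexRingEquiv ℤ finProdFinEquiv)
  have square : propusPattern A B D * propusPattern A B D = (4 * (n : ℤ)) • 1 := by
    have additive := h.additive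
    rw [Fintype.card_fin] at additive
    rw [propusPattern_mul_self h.commute_AB h.commute_AD h.commute_BD, additive, map_zsmul, map_one]
  calc blocks (propusPattern A B D) * blocks (propusPattern A B D)
      = blocks ((4 * (n : ℤ)) • 1) := by rw [← map_mul, square]
    _ = (4 * (n : ℤ)) • 1 := by rw [map_zsmul, map_one]

theorem propusArray_isSymm {n : ℕ} {A B D : Matrix (Fin n) (Fin n) ℤ} (hA : A.IsSymm)
    (hB : B.IsSymm) (hD : D.IsSymm) : (propusArray A B D).IsSymm := by
  rw [propusArray, reindex_apply]
  refine IsSymm.submatrix ?_ _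
  ext ⟨i, k⟩ ⟨j, l⟩
  fin_cases i <;> fin_cases j <;>
    simp only [transpose_apply, comp_apply, of_apply, cons_val, Fin.zero_eta, Fin.mk_one,
      Fin.reduceFinMk, Matrix.neg_apply, hA.apply k l, hB.apply k l, hD.apply k l]

theorem propusArray_isSignMatrix {n : ℕ} {A B D : Matrix (Fin n) (Fin n) ℤ}
    (hA : IsSignMatrix A) (hB : IsSignMatrix B) (hD : IsSignMatrix D) :
    IsSignMatrix (propusArray A B D) := by
  suffices ∀ i j, comp (Fin 4) (Fin 4) (Fin n) (Fin n) ℤ (propusPattern A B D) i j = 1 ∨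
      comp (Fin 4) (Fin 4) (Fin n) (Fin n) ℤ (propusPattern A B D) i j = -1 from
    fun i j => this (finProdFinEquiv.symm i) (finProdFinEquiv.symm j)
  rintro ⟨i, k⟩ ⟨j, l⟩
  have neg_sign {x : ℤ} (hx : x = 1 ∨ x = -1) : -x = 1 ∨ -x = -1 := by omega
  have hA' := neg_sign (hA k l)
  have hB' := neg_sign (hB k l)
  have hD' := neg_sign (hD k l)
  fin_cases i <;> fin_cases j <;>
    first | exact hA k l | exact hB k l | exact hD k l | assumption

theorem isHadamard_of_isSymm {M : Matrix ι ι ℤ} (sign : ∀ i j, M i j = 1 ∨ M i j = -1)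
    (symm : M.IsSymm) (h : M * M = (Fintype.card ι : ℤ) • 1) : M.IsHadamard := by
  have hM : Mᴴ = M := by rw [conjTranspose_eq_transpose_of_trivial, symm.eq]
  refine ⟨fun i j => ?_, by rw [hM, h], by rw [hM, h]⟩
  rcases sign i j with hij | hij <;> simp [hij, Unitary.mem_iff]

theorem IsSymmetricPropus.isSymmetricPropusTypeHadamard {n : ℕ} {A B D : Matrix (Fin n) (Fin n) ℤ}
    (h : IsSymmetricPropus A B D) : IsSymmetricPropusTypeHadamard (propusArray A B D) := by
  have symm := propusArray_isSymm h.symm_A h.symm_B h.symm_D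
  refine ⟨⟨A, B, D, h.isPropusType, rfl⟩, symm,
    isHadamard_of_isSymm (propusArray_isSignMatrix h.sign_A h.sign_B h.sign_D) symm ?_⟩
  rw [propusArray_mul_self h, Fintype.card_fin, Nat.cast_mul, Nat.cast_ofNat]

theorem IsSymmetricPropus.exists_isSymmetricWilliamsonType_and_hadamard {m : ℕ}
    {A B D : Matrix ι ι ℤ} (h : IsSymmetricPropus A B D) (hm : Fintype.card ι = m) :
    (∃ W : Fin 4 → Matrix (Fin m) (Fin m) ℤ, IsSymmetricWilliamsonType W) ∧
      ∃ H : Matrix (Fin (4 * m)) (Fin (4 * m)) ℤ, IsSymmetricPropusTypeHadamard H :=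
  have h' := h.submatrix (Fintype.equivFinOfCardEq hm).symm
  ⟨⟨_, h'.isSymmetricWilliamsonType⟩, _, h'.isSymmetricPropusTypeHadamard⟩

end PropusMatrices

section Doubling

variable {ι : Type*}

/-- The matrix `[[U + V, U - V], [U - V, U + V]]`. Up to a factor `2` in products it is the direct
sum of `U` and `V` in the basis of sums and differences, which makes it multiplicative in `U`
and `V`. -/
def doubling (U V : Matrix ι ι ℤ) : Matrix (ι ⊕ ι) (ι ⊕ ι) ℤ :=
  fromBlocks (U + V) (U - V) (U - V) (U + V)

theorem doubling_isSymm {U V : Matrix ι ι ℤ} (hU : U.IsSymm) (hV : V.IsSymm) :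
    (doubling U V).IsSymm :=
  IsSymm.fromBlocks (hU.add hV) (by rw [transpose_sub, hU.eq, hV.eq]) (hU.add hV)

theorem doubling_sign {U V : Matrix ι ι ℤ}
    (h : ∀ i j, (U i j = 0 ∧ (V i j = 1 ∨ V i j = -1)) ∨ (V i j = 0 ∧ (U i j = 1 ∨ U i j = -1))) :
    ∀ i j, doubling U V i j = 1 ∨ doubling U V i j = -1 := by
  rintro (i | i) (j | j) <;>
    simp only [doubling, fromBlocks_apply₁₁, fromBlocks_apply₁₂, fromBlocks_apply₂₁,
      fromBlocks_apply₂₂, Matrix.add_apply, Matrix.sub_apply] <;>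
    grind

variable [Fintype ι]

theorem doubling_mul (U V U' V' : Matrix ι ι ℤ) :
    doubling U V * doubling U' V' = (2 : ℤ) • doubling (U * U') (V * V') := by
  rw [doubling, doubling, doubling, fromBlocks_multiply, fromBlocks_smul]
  congr 1 <;> noncomm_ring

theorem doubling_commute {U V U' V' : Matrix ι ι ℤ} (hU : Commute U U') (hV : Commute V V') :
    Commute (doubling U V) (doubling U' V') := by
  rw [commute_iff_eq, doubling_mul, doubling_mul, hU.eq, hV.eq]

theorem sum_doubling {U : Matrix ι ι ℤ} {r : ℤ} (hU : ∀ i, ∑ j, U i j = r) (V : Matrix ι ι ℤ) :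
    ∀ i, ∑ j, doubling U V i j = 2 * r := by
  rintro (i | i) <;>
    simp [doubling, Fintype.sum_sum_type, Finset.sum_add_distrib, hU, two_mul]

end Doubling

section Border

variable {κ : Type*}

/-- The matrix `M` bordered by a row and a column with constant entry `s`, with corner entry `1`. -/
def border (s : ℤ) (M : Matrix κ κ ℤ) : Matrix (Unit ⊕ κ) (Unit ⊕ κ) ℤ :=
  fromBlocks 1 (of fun _ _ => s) (of fun _ _ => s) M

theorem border_isSymm (s : ℤ) {M : Matrix κ κ ℤ} (hM : M.IsSymm) : (border s M).IsSymm :=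
  IsSymm.fromBlocks isSymm_one rfl hM

theorem border_sign {s : ℤ} (hs : s = 1 ∨ s = -1) {M : Matrix κ κ ℤ}
    (hM : ∀ i j, M i j = 1 ∨ M i j = -1) : ∀ i j, border s M i j = 1 ∨ border s M i j = -1 := by
  rintro (i | i) (j | j)
  exacts [.inl rfl, hs, hs, hM i j]

variable [Fintype κ]

theorem border_mul (s t : ℤ) {M N : Matrix κ κ ℤ} {r r' : ℤ} (hM : ∀ i, ∑ j, M i j = r)
    (hN : ∀ j, ∑ i, N i j = r') :
    border s M * border t N =
      fromBlocks (of fun _ _ => 1 + Fintype.card κ * (s * t)) (of fun _ _ => t + s * r')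
        (of fun _ _ => s + r * t) ((of fun _ _ => s * t) + M * N) := by
  rw [border, border, fromBlocks_multiply]
  congr 1 <;> ext i j <;>
    simp [Matrix.mul_apply, ← Finset.mul_sum, ← Finset.sum_mul, hM, hN]

theorem sum_col_of_isSymm {M : Matrix κ κ ℤ} {r : ℤ} (hM : M.IsSymm) (h : ∀ i, ∑ j, M i j = r) :
    ∀ j, ∑ i, M i j = r := by
  simpa only [hM.apply] using h

theorem border_commute {s t r r' : ℤ} {M N : Matrix κ κ ℤ} (hM : M.IsSymm) (hN : N.IsSymm)
    (hMr : ∀ i, ∑ j, M i j = r) (hNr : ∀ i, ∑ j, N i j = r') (hMN : Commute M N)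
    (h : t + s * r' = s + t * r) : Commute (border s M) (border t N) := by
  rw [commute_iff_eq, border_mul s t hMr (sum_col_of_isSymm hN hNr),
    border_mul t s hNr (sum_col_of_isSymm hM hMr), hMN.eq, mul_comm r t, mul_comm r' s, h,
    mul_comm s t]

theorem isSymmetricPropus_border [DecidableEq κ] {X Y Z : Matrix κ κ ℤ}
    (sign_X : ∀ i j, X i j = 1 ∨ X i j = -1) (sign_Y : ∀ i j, Y i j = 1 ∨ Y i j = -1)
    (sign_Z : ∀ i j, Z i j = 1 ∨ Z i j = -1) (symm_X : X.IsSymm) (symm_Y : Y.IsSymm)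
    (symm_Z : Z.IsSymm) (sum_X : ∀ i, ∑ j, X i j = 2) (sum_Y : ∀ i, ∑ j, Y i j = 0)
    (sum_Z : ∀ i, ∑ j, Z i j = 0) (hXY : Commute X Y) (hXZ : Commute X Z) (hYZ : Commute Y Z)
    (additive : X * X + (2 : ℤ) • (Y * Y) + Z * Z =
      (4 * ((Fintype.card κ : ℤ) + 1)) • 1 - of fun _ _ => 4) :
    IsSymmetricPropus (border (-1) X) (border 1 Y) (border 1 Z) where
  sign_A := border_sign (.inr rfl) sign_X
  sign_B := border_sign (.inl rfl) sign_Y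
  sign_D := border_sign (.inl rfl) sign_Z
  symm_A := border_isSymm _ symm_X
  symm_B := border_isSymm _ symm_Y
  symm_D := border_isSymm _ symm_Z
  commute_AB := border_commute symm_X symm_Y sum_X sum_Y hXY (by norm_num)
  commute_AD := border_commute symm_X symm_Z sum_X sum_Z hXZ (by norm_num)
  commute_BD := border_commute symm_Y symm_Z sum_Y sum_Z hYZ (by norm_num)
  additive := by
    rw [border_mul _ _ sum_X (sum_col_of_isSymm symm_X sum_X),
      border_mul _ _ sum_Y (sum_col_of_isSymm symm_Y sum_Y),
      border_mul _ _ sum_Z (sum_col_of_isSymm symm_Z sum_Z), fromBlocks_smul, fromBlocks_add,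
      fromBlocks_add, ← fromBlocks_one, fromBlocks_smul, Fintype.card_sum, Fintype.card_unit,
      Nat.cast_add, Nat.cast_one, add_comm 1 (Fintype.card κ : ℤ),
      eq_sub_of_add_eq (eq_sub_of_add_eq additive)]
    congr 1 <;> ext i j <;>
      simp only [Matrix.add_apply, Matrix.sub_apply, Matrix.smul_apply, smul_eq_mul, of_apply,
        one_apply_eq] <;>
      ring

end Border

section Cores

variable {ι κ : Type*} [Fintype ι] [DecidableEq ι] [Fintype κ] [DecidableEq κ]

/-- A matrix with the properties of the core of a symmetric conference matrix, except that its
zeros form the permutation matrix of `σ` instead of the identity matrix. -/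
structure IsConferenceCoreAlong (σ : Equiv.Perm ι) (P : Matrix ι ι ℤ) : Prop where
  symm : P.IsSymm
  apply_perm : ∀ i, P i (σ i) = 0
  sign : ∀ i j, σ i ≠ j → P i j = 1 ∨ P i j = -1
  mul_self : P * P = (Fintype.card ι : ℤ) • (1 : Matrix ι ι ℤ) - of fun _ _ => 1

namespace IsConferenceCoreAlong

variable {σ : Equiv.Perm ι} {P : Matrix ι ι ℤ}

theorem perm_mul_self (h : IsConferenceCoreAlong σ P) : σ * σ = 1 := by
  ext i
  by_contra hi
  have zero : P (σ i) i = 0 := by rw [← h.symm.apply, h.apply_perm]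
  rcases h.sign (σ i) i hi with hs | hs <;> omega

-- The vector of row sums is `P *ᵥ 1`, whose squared norm is the sum of the entries of `P * P`.
theorem sum_row (h : IsConferenceCoreAlong σ P) (i : ι) : ∑ j, P i j = 0 := by
  have norm_sq : (P *ᵥ 1) ⬝ᵥ (P *ᵥ 1) = 0 := by
    calc (P *ᵥ 1) ⬝ᵥ (P *ᵥ 1) = 1 ⬝ᵥ ((P * P) *ᵥ 1) := by
          rw [← mulVec_mulVec, dotProduct_mulVec 1, ← mulVec_transpose, h.symm.eq]
      _ = 0 := by
          rw [h.mul_self, sub_mulVec, smul_mulVec, one_mulVec]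
          simp [dotProduct, mulVec]
  simpa [mulVec, dotProduct] using congrFun (dotProduct_self_eq_zero.1 norm_sq) i

theorem submatrix (h : IsConferenceCoreAlong σ P) (e : κ ≃ ι) :
    IsConferenceCoreAlong (e.symm.permCongr σ) (P.submatrix e e) where
  symm := h.symm.submatrix e
  apply_perm i := by simpa [Equiv.permCongr_apply] using h.apply_perm (e i)
  sign i j hij := h.sign _ _ fun hs => hij (by simp [Equiv.permCongr_apply, hs])
  mul_self := by
    rw [submatrix_mul_equiv, h.mul_self, Fintype.card_congr e]
    ext i j
    simp only [submatrix_apply, Matrix.sub_apply, Matrix.smul_apply, Matrix.one_apply, of_apply,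
      e.injective.eq_iff]

end IsConferenceCoreAlong

theorem isSymmetricConferenceCore_iff {n : ℕ} {Q : Matrix (Fin n) (Fin n) ℤ} :
    IsSymmetricConferenceCore Q ↔ IsConferenceCoreAlong 1 Q := by
  constructor
  · intro h
    have symm : Q.IsSymm := by
      ext i j
      exact h.symm.apply (Sum.inr i) (Sum.inr j)
    refine ⟨symm, fun i => h.diag (Sum.inr i), fun i j hij =>
      h.off_diag (Sum.inr i) (Sum.inr j) (by simpa using hij), ?_⟩
    have blocks := congrArg toBlocks₂₂ h.mul_transpose
    rw [fromBlocks_transpose, symm.eq, fromBlocks_multiply, toBlocks_fromBlocks₂₂,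
      ← eq_sub_iff_add_eq'] at blocks
    rw [blocks]
    ext i j
    simp [Matrix.mul_apply, toBlocks₂₂, Matrix.natCast_apply, Matrix.one_apply]
  · intro h
    have sum_col := sum_col_of_isSymm h.symm h.sum_row
    refine ⟨?_, ?_, IsSymm.fromBlocks isSymm_zero rfl h.symm, ?_⟩
    · rintro (i | i)
      exacts [rfl, h.apply_perm i]
    · rintro (i | i) (j | j) hij
      exacts [(hij rfl).elim, .inl rfl, .inl rfl, h.sign i j fun hs => hij (congrArg Sum.inr hs)]
    · rw [fromBlocks_transpose, h.symm.eq, fromBlocks_multiply, h.mul_self, ← fromBlocks_one,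
        fromBlocks_smul]
      congr 1 <;> ext i j <;>
        simp [Matrix.mul_apply, h.sum_row, sum_col, Matrix.natCast_apply, Matrix.one_apply]

/-- A symmetric conference pair: two symmetric commuting matrices `A`, `B` of order `n` such that
`[[A, B], [B, -A]]` is a symmetric conference matrix of order `2 n`. -/
structure IsSymmetricConferencePair (A B : Matrix ι ι ℤ) : Prop where
  symm_A : A.IsSymm
  symm_B : B.IsSymm
  diag_A : ∀ i, A i i = 0
  sign_A : ∀ i j, i ≠ j → A i j = 1 ∨ A i j = -1
  sign_B : ∀ i j, B i j = 1 ∨ B i j = -1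
  commute : Commute A B
  additive : A * A + B * B = (2 * (Fintype.card ι : ℤ) - 1) • (1 : Matrix ι ι ℤ)

theorem permMatrix_commute {σ : Equiv.Perm ι} {M : Matrix ι ι ℤ}
    (h : ∀ i j, M (σ i) (σ j) = M i j) : Commute (σ.permMatrix ℤ) M := by
  rw [commute_iff_eq, Equiv.Perm.permMatrix, PEquiv.toMatrix_toPEquiv_mul,
    PEquiv.mul_toMatrix_toPEquiv]
  ext i j
  simpa using h i (σ.symm j)

theorem IsSymmetricConferencePair.sum_doubling_sq {A B P : Matrix ι ι ℤ} {σ : Equiv.Perm ι}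
    (hAB : IsSymmetricConferencePair A B) (hP : IsConferenceCoreAlong σ P) :
    doubling 1 A * doubling 1 A + (2 : ℤ) •
        (doubling P (σ.permMatrix ℤ) * doubling P (σ.permMatrix ℤ)) + doubling 0 B * doubling 0 B =
      (4 * ((Fintype.card (ι ⊕ ι) : ℤ) + 1)) • 1 - of fun _ _ => 4 := by
  have hR : σ.permMatrix ℤ * σ.permMatrix ℤ = 1 := by
    rw [← permMatrix_mul, hP.perm_mul_self, permMatrix_one]
  rw [doubling_mul, doubling_mul, doubling_mul, eq_sub_of_add_eq hAB.additive, hP.mul_self, hR,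
    Fintype.card_sum, Nat.cast_add]
  ext (i | i) (j | j) <;>
    simp only [doubling, Matrix.add_apply, Matrix.sub_apply, Matrix.smul_apply, smul_eq_mul,
      fromBlocks_apply₁₁, fromBlocks_apply₁₂, fromBlocks_apply₂₁, fromBlocks_apply₂₂, of_apply,
      Matrix.one_apply, mul_zero, mul_one, Matrix.zero_apply, Sum.inr.injEq, Sum.inl.injEq,
      reduceCtorEq, if_false] <;>
    ring

theorem IsSymmetricConferencePair.isSymmetricPropus {A B P : Matrix ι ι ℤ} {σ : Equiv.Perm ι}
    (hAB : IsSymmetricConferencePair A B) (hP : IsConferenceCoreAlong σ P)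
    (hA : Commute (σ.permMatrix ℤ) A) (hB : Commute (σ.permMatrix ℤ) B) :
    IsSymmetricPropus (border (-1) (doubling 1 A)) (border 1 (doubling P (σ.permMatrix ℤ)))
      (border 1 (doubling 0 B)) := by
  have symm_R : (σ.permMatrix ℤ).IsSymm := by
    rw [IsSymm, transpose_permMatrix, inv_eq_of_mul_eq_one_right hP.perm_mul_self]
  refine isSymmetricPropus_border (doubling_sign fun i j => ?_) (doubling_sign fun i j => ?_)
    (doubling_sign fun i j => .inl ⟨rfl, hAB.sign_B i j⟩) (doubling_isSymm isSymm_one hAB.symm_A)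
    (doubling_isSymm hP.symm symm_R) (doubling_isSymm isSymm_zero hAB.symm_B)
    (sum_doubling (r := 1) (fun i => by simp [Matrix.one_apply]) A) (sum_doubling hP.sum_row _)
    (sum_doubling (r := 0) (by simp) B) (doubling_commute (Commute.one_left _) hA.symm)
    (doubling_commute (Commute.one_left _) hAB.commute)
    (doubling_commute (Commute.zero_right _) hB) (hAB.sum_doubling_sq hP)
  · rcases eq_or_ne i j with rfl | hij
    · exact .inr ⟨hAB.diag_A i, .inl (Matrix.one_apply_eq i)⟩
    · exact .inl ⟨Matrix.one_apply_ne hij, hAB.sign_A i j hij⟩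
  · rcases eq_or_ne (σ i) j with rfl | hij
    · exact .inl ⟨hP.apply_perm i, .inl (by simp [Equiv.Perm.permMatrix, PEquiv.toMatrix_apply])⟩
    · exact .inr ⟨by simp [Equiv.Perm.permMatrix, PEquiv.toMatrix_apply, hij], hP.sign i j hij⟩

end Cores

section QuadraticExtension

open QuadraticAlgebra

theorem norm_smul_eq_sq_mul {R : Type*} [CommRing R] {a b : R} (c : R)
    (z : QuadraticAlgebra R a b) :
    QuadraticAlgebra.norm (c • z) = c ^ 2 * QuadraticAlgebra.norm z := by
  simp only [QuadraticAlgebra.norm_def, re_smul, im_smul, smul_eq_mul]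
  ring

variable {F : Type*} [Field F] {d : F} {n : ℕ}

/-- The element `c g` or `c ω g` of `F(√d)`, with `c` a nonzero element of `F`, `ω = √d` and `g` an
`n`-th root of unity. When `2 n = |F| + 1` is twice an odd number and neither `d` nor `-d` is a
square, these elements exhaust the nonzero elements of `F(√d)` without repetition. -/
def scaledRoot (d : F) (n : ℕ) : Fˣ × (rootsOfUnity n (QuadraticAlgebra F d 0) ⊕
    rootsOfUnity n (QuadraticAlgebra F d 0)) → QuadraticAlgebra F d 0
  | (c, .inl g) => (c : F) • (g.1 : QuadraticAlgebra F d 0)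
  | (c, .inr g) => (c : F) • (omega * (g.1 : QuadraticAlgebra F d 0))

theorem omega_ne_zero : (omega : QuadraticAlgebra F d 0) ≠ 0 :=
  fun h => by simpa using congrArg im h

theorem fact_of_not_isSquare (hd : ¬ IsSquare d) : Fact (∀ r, r ^ 2 ≠ d + 0 * r) :=
  ⟨fun r hr => hd ⟨r, by rw [← sq, hr, zero_mul, add_zero]⟩⟩

theorem ringChar_ne_two_of_not_isSquare [Finite F] (hd : ¬ IsSquare d) : ringChar F ≠ 2 :=
  fun h => hd (FiniteField.isSquare_of_char_two h d)

variable {z w : QuadraticAlgebra F d 0}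

theorem pow_ne_one_of_neg_pow_eq_one [Finite F] (hd : ¬ IsSquare d) (hodd : Odd n)
    (hz : (-z) ^ n = 1) : z ^ n ≠ 1 := by
  intro h
  rw [hodd.neg_pow, h] at hz
  exact Ring.neg_one_ne_one_of_char_ne_two (ringChar_ne_two_of_not_isSquare hd)
    (by simpa using congrArg re hz)

theorem re_ne_zero_of_pow_eq_one [Finite F] (hd : ¬ IsSquare d) (hodd : Odd n) (hz : z ^ n = 1) :
    z.re ≠ 0 := by
  intro hre
  have star_eq : star z = -z := by ext <;> simp [hre]
  refine pow_ne_one_of_neg_pow_eq_one hd hodd ?_ hz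
  rw [← star_eq, ← star_pow, hz, star_one]

variable [Fintype F]

theorem star_eq_pow_card (hd : ¬ IsSquare d) (z : QuadraticAlgebra F d 0) :
    star z = z ^ Fintype.card F := by
  have hF := ringChar_ne_two_of_not_isSquare hd
  have hd0 : d ≠ 0 := fun h => hd (h ▸ IsSquare.zero)
  have euler : d ^ (Fintype.card F / 2) = -1 :=
    (FiniteField.pow_dichotomy hF hd0).resolve_left fun h =>
      hd ((FiniteField.isSquare_iff hF hd0).2 h)
  have omega_pow : (omega : QuadraticAlgebra F d 0) ^ Fintype.card F = -omega := by
    have odd_card := Nat.odd_iff.2 (FiniteField.odd_card_of_char_ne_two hF)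
    rw [← Nat.two_mul_div_two_add_one_of_odd odd_card, pow_succ, pow_mul, sq,
      omega_mul_omega_eq_algebraMap, map_zero, zero_mul, add_zero, ← map_pow, euler, map_neg,
      map_one, neg_one_mul]
  calc star z = algebraMap F _ z.re + z.im • -omega := by ext <;> simp
    _ = FiniteField.frobeniusAlgHom F _ (algebraMap F _ z.re + z.im • omega) := by
        rw [map_add, map_smul, AlgHom.commutes, FiniteField.coe_frobeniusAlgHom]
        simp only [omega_pow]
    _ = z ^ Fintype.card F := by
        rw [FiniteField.coe_frobeniusAlgHom]
        congr 1
        ext <;> simp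

theorem mul_star_eq_one_of_pow_eq_one (hd : ¬ IsSquare d) (hn : 2 * n = Fintype.card F + 1)
    (hz : z ^ n = 1) : z * star z = 1 := by
  rw [star_eq_pow_card hd, ← pow_succ', ← hn, mul_comm, pow_mul, hz, one_pow]

theorem norm_eq_one_of_pow_eq_one (hd : ¬ IsSquare d) (hn : 2 * n = Fintype.card F + 1)
    (hz : z ^ n = 1) : QuadraticAlgebra.norm z = 1 :=
  algebraMap_injective (by
    rw [algebraMap_norm_eq_mul_star, mul_star_eq_one_of_pow_eq_one hd hn hz, map_one])

theorem eq_one_of_im_eq_zero (hd : ¬ IsSquare d) (hn : 2 * n = Fintype.card F + 1) (hodd : Odd n)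
    (hz : z ^ n = 1) (him : z.im = 0) : z = 1 := by
  have star_eq : star z = z := by ext <;> simp [him]
  have hz2 := mul_star_eq_one_of_pow_eq_one hd hn hz
  rw [star_eq, ← sq] at hz2
  rw [← hz, ← Nat.two_mul_div_two_add_one_of_odd hodd, pow_succ, pow_mul, hz2, one_pow, one_mul]

theorem eq_and_eq_of_smul_eq_smul (hd : ¬ IsSquare d) (hn : 2 * n = Fintype.card F + 1)
    (hodd : Odd n) (hz : z ^ n = 1) (hw : w ^ n = 1) {c c' : F} (hc' : c' ≠ 0)
    (h : c • z = c' • w) : c = c' ∧ z = w := by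
  have sq_eq : c ^ 2 = c' ^ 2 := by
    simpa only [norm_smul_eq_sq_mul, norm_eq_one_of_pow_eq_one hd hn hz,
      norm_eq_one_of_pow_eq_one hd hn hw, mul_one] using congrArg QuadraticAlgebra.norm h
  rcases sq_eq_sq_iff_eq_or_eq_neg.1 sq_eq with rfl | rfl
  · exact ⟨rfl, smul_right_injective _ hc' h⟩
  · rw [neg_smul, ← smul_neg] at h
    have hzw : -z = w := smul_right_injective _ hc' h
    exact absurd hz (pow_ne_one_of_neg_pow_eq_one hd hodd (hzw ▸ hw))

theorem smul_ne_smul_omega_mul (hd : ¬ IsSquare d) (hd' : ¬ IsSquare (-d))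
    (hn : 2 * n = Fintype.card F + 1) (hz : z ^ n = 1) (hw : w ^ n = 1) (c : F) {c' : F}
    (hc' : c' ≠ 0) : c • z ≠ c' • (omega * w) := by
  intro h
  have norm_omega : QuadraticAlgebra.norm (omega : QuadraticAlgebra F d 0) = -d := by
    simp [QuadraticAlgebra.norm_def]
  have sq_eq : c ^ 2 = c' ^ 2 * -d := by
    simpa only [norm_smul_eq_sq_mul, map_mul, norm_eq_one_of_pow_eq_one hd hn hz,
      norm_eq_one_of_pow_eq_one hd hn hw, mul_one, norm_omega]
      using congrArg QuadraticAlgebra.norm h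
  refine hd' ⟨c / c', ?_⟩
  field_simp
  linear_combination -sq_eq

theorem scaledRoot_injective (hd : ¬ IsSquare d) (hd' : ¬ IsSquare (-d))
    (hn : 2 * n = Fintype.card F + 1) (hodd : Odd n) : Function.Injective (scaledRoot d n) := by
  have := fact_of_not_isSquare hd
  have root (g : rootsOfUnity n (QuadraticAlgebra F d 0)) :
      (g.1 : QuadraticAlgebra F d 0) ^ n = 1 := (mem_rootsOfUnity' n g.1).1 g.2
  rintro ⟨c, g | g⟩ ⟨c', g' | g'⟩ h
  · obtain ⟨hc, hg⟩ := eq_and_eq_of_smul_eq_smul hd hn hodd (root g) (root g') c'.ne_zero h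
    rw [Units.ext hc, Subtype.ext (Units.ext hg)]
  · exact (smul_ne_smul_omega_mul hd hd' hn (root g) (root g') c c'.ne_zero h).elim
  · exact (smul_ne_smul_omega_mul hd hd' hn (root g') (root g) c' c.ne_zero h.symm).elim
  · simp only [scaledRoot, ← mul_smul_comm] at h
    obtain ⟨hc, hg⟩ := eq_and_eq_of_smul_eq_smul hd hn hodd (root g) (root g') c'.ne_zero
      (mul_left_cancel₀ omega_ne_zero h)
    rw [Units.ext hc, Subtype.ext (Units.ext hg)]

theorem card_rootsOfUnity_of_dvd {K : Type*} [Field K] [Finite K] {n : ℕ}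
    (h : n ∣ Nat.card Kˣ) : Nat.card (rootsOfUnity n K) = n := by
  rw [rootsOfUnity_eq_ker, IsCyclic.card_powMonoidHom_ker, Nat.gcd_eq_right h]

theorem card_units_quadraticAlgebra (hd : ¬ IsSquare d) (hn : 2 * n = Fintype.card F + 1) :
    Nat.card (QuadraticAlgebra F d 0)ˣ = Nat.card Fˣ * (n + n) := by
  have := fact_of_not_isSquare hd
  rw [Nat.card_units, Nat.card_units, Nat.card_congr (equivProd d 0), Nat.card_prod,
    Nat.card_eq_fintype_card, ← two_mul, hn, ← sq, mul_comm, ← Nat.sq_sub_sq, one_pow]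

theorem card_rootsOfUnity_quadraticAlgebra (hd : ¬ IsSquare d) (hn : 2 * n = Fintype.card F + 1) :
    Nat.card (rootsOfUnity n (QuadraticAlgebra F d 0)) = n := by
  have := fact_of_not_isSquare hd
  have := Finite.of_equiv _ (equivProd d 0).symm
  refine card_rootsOfUnity_of_dvd ?_
  rw [card_units_quadraticAlgebra hd hn, ← two_mul]
  exact (dvd_mul_left _ _).mul_left _

theorem image_scaledRoot [DecidableEq F] [Fintype (QuadraticAlgebra F d 0)]
    [Fintype (rootsOfUnity n (QuadraticAlgebra F d 0))] (hd : ¬ IsSquare d)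
    (hd' : ¬ IsSquare (-d)) (hn : 2 * n = Fintype.card F + 1) (hodd : Odd n) :
    Finset.univ.image (scaledRoot d n) = Finset.univ.erase 0 := by
  have := fact_of_not_isSquare hd
  refine Finset.eq_of_subset_of_card_le (fun z hz => ?_) ?_
  · obtain ⟨⟨c, g | g⟩, -, rfl⟩ := Finset.mem_image.1 hz <;> simp [scaledRoot, omega_ne_zero]
  · rw [Finset.card_image_of_injective _ (scaledRoot_injective hd hd' hn hodd),
      Finset.card_erase_of_mem (Finset.mem_univ _), Finset.card_univ, Finset.card_univ,
      Fintype.card_prod, Fintype.card_sum, ← Nat.card_eq_fintype_card (α := QuadraticAlgebra F d 0),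
      ← Nat.card_units, card_units_quadraticAlgebra hd hn, Nat.card_eq_fintype_card,
      ← Nat.card_eq_fintype_card (α := rootsOfUnity n _), card_rootsOfUnity_quadraticAlgebra hd hn]

theorem sum_eq_card_units_smul_sum_rootsOfUnity [DecidableEq F] [Fintype (QuadraticAlgebra F d 0)]
    [Fintype (rootsOfUnity n (QuadraticAlgebra F d 0))] (hd : ¬ IsSquare d)
    (hd' : ¬ IsSquare (-d)) (hn : 2 * n = Fintype.card F + 1) (hodd : Odd n) {M : Type*}
    [AddCommMonoid M] {T : QuadraticAlgebra F d 0 → M} (zero : T 0 = 0)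
    (smul : ∀ (c : Fˣ) z, T ((c : F) • z) = T z) :
    ∑ z, T z = Fintype.card Fˣ • ∑ g : rootsOfUnity n (QuadraticAlgebra F d 0),
      (T g.1 + T (omega * (g.1 : QuadraticAlgebra F d 0))) := by
  rw [← Finset.sum_erase _ zero, ← image_scaledRoot hd hd' hn hodd,
    Finset.sum_image (scaledRoot_injective hd hd' hn hodd).injOn, Fintype.sum_prod_type]
  simp only [Fintype.sum_sum_type, scaledRoot, smul, Finset.sum_const, Finset.sum_add_distrib,
    Finset.card_univ]

theorem sum_quadraticChar_mul_bilinear [DecidableEq F] [Fintype (QuadraticAlgebra F d 0)]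
    (hF : ringChar F ≠ 2) {x y : QuadraticAlgebra F d 0} (h : (star x * y).im ≠ 0) :
    ∑ z : QuadraticAlgebra F d 0,
      quadraticChar F (star x * z).im * quadraticChar F (star y * z).im = 0 := by
  let coords : QuadraticAlgebra F d 0 → F × F := fun z => ((star x * z).im, (star y * z).im)
  have injective : Function.Injective coords := by
    intro z w hzw
    simp only [coords, Prod.mk.injEq, im_mul, re_star, im_star, zero_mul, add_zero] at hzw h
    obtain ⟨hx, hy⟩ := hzw
    ext
    · refine mul_left_cancel₀ h ?_
      linear_combination y.re * hx - x.re * hy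
    · refine mul_left_cancel₀ h ?_
      linear_combination y.im * hx - x.im * hy
  have bijective : Function.Bijective coords := by
    rw [Fintype.bijective_iff_injective_and_card]
    exact ⟨injective, Fintype.card_congr (equivProd d 0)⟩
  rw [bijective.sum_comp fun u : F × F => quadraticChar F u.1 * quadraticChar F u.2,
    Fintype.sum_prod_type]
  simp only [← Finset.mul_sum, quadraticChar_sum_zero hF, mul_zero, Finset.sum_const_zero]

theorem coe_inv_rootsOfUnity (hd : ¬ IsSquare d) (hn : 2 * n = Fintype.card F + 1)
    (g : rootsOfUnity n (QuadraticAlgebra F d 0)) :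
    ((g⁻¹).1 : QuadraticAlgebra F d 0) = star (g.1 : QuadraticAlgebra F d 0) :=
  (Units.eq_inv_of_mul_eq_one_left
    (mul_star_eq_one_of_pow_eq_one hd hn ((mem_rootsOfUnity' n g.1).1 g.2))).symm

theorem sum_quadraticChar_rootsOfUnity [DecidableEq F]
    [Fintype (rootsOfUnity n (QuadraticAlgebra F d 0))] (hd : ¬ IsSquare d)
    (hd' : ¬ IsSquare (-d)) (hn : 2 * n = Fintype.card F + 1) (hodd : Odd n)
    {k : rootsOfUnity n (QuadraticAlgebra F d 0)} (hk : k ≠ 1) :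
    ∑ g : rootsOfUnity n (QuadraticAlgebra F d 0),
      (quadraticChar F (g.1 : QuadraticAlgebra F d 0).im *
          quadraticChar F ((k⁻¹ * g).1 : QuadraticAlgebra F d 0).im +
        quadraticChar F (g.1 : QuadraticAlgebra F d 0).re *
          quadraticChar F ((k⁻¹ * g).1 : QuadraticAlgebra F d 0).re) = 0 := by
  let : Fintype (QuadraticAlgebra F d 0) := Fintype.ofEquiv _ (equivProd d 0).symm
  let T (z : QuadraticAlgebra F d 0) : ℤ :=
    quadraticChar F (star (1 : QuadraticAlgebra F d 0) * z).im *
      quadraticChar F (star (k.1 : QuadraticAlgebra F d 0) * z).im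
  have smul (c : Fˣ) z : T ((c : F) • z) = T z := by
    have sq_one : quadraticChar F (c : F) ^ 2 = 1 := quadraticChar_sq_one c.ne_zero
    simp only [T, mul_smul_comm, im_smul, smul_eq_mul, map_mul]
    linear_combination (quadraticChar F (star (1 : QuadraticAlgebra F d 0) * z).im *
      quadraticChar F (star (k.1 : QuadraticAlgebra F d 0) * z).im) * sq_one
  have im_ne_zero : (star (1 : QuadraticAlgebra F d 0) * k.1).im ≠ 0 := by
    rw [star_one, one_mul]
    exact fun him => hk (Subtype.ext (Units.ext
      (eq_one_of_im_eq_zero hd hn hodd ((mem_rootsOfUnity' n k.1).1 k.2) him)))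
  have sum_T := sum_quadraticChar_mul_bilinear (ringChar_ne_two_of_not_isSquare hd) im_ne_zero
  rw [sum_eq_card_units_smul_sum_rootsOfUnity hd hd' hn hodd (T := T) (by simp [T]) smul,
    smul_eq_zero, or_iff_right Fintype.card_ne_zero] at sum_T
  rw [← sum_T]
  refine Finset.sum_congr rfl fun g _ => ?_
  simp only [T, star_one, one_mul, Subgroup.coe_mul, Units.val_mul, coe_inv_rootsOfUnity hd hn,
    mul_left_comm _ omega]
  simp

end QuadraticExtension

section Circulant

variable {G : Type*} [AddCommGroup G] [Fintype G] [DecidableEq G] {a b : G → ℤ}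

theorem circulant_sq_add_sq (even_a : a.Even) (even_b : b.Even) (zero_a : a 0 = 0)
    (sign_a : ∀ g, g ≠ 0 → a g = 1 ∨ a g = -1) (sign_b : ∀ g, b g = 1 ∨ b g = -1)
    (h : ∀ k, k ≠ 0 → ∑ g, (a g * a (-k + g) + b g * b (-k + g)) = 0) :
    circulant a * circulant a + circulant b * circulant b =
      (2 * (Fintype.card G : ℤ) - 1) • (1 : Matrix G G ℤ) := by
  have sq_a (g : G) : a g * a g = 1 - if g = 0 then 1 else 0 := by
    split_ifs with hg
    · simp [hg, zero_a]
    · rcases sign_a g hg with h | h <;> simp [h]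
  have sq_b (g : G) : b g * b g = 1 := by rcases sign_b g with h | h <;> simp [h]
  have convolution (k : G) : ∑ g, a (k - g) * a g + ∑ g, b (k - g) * b g =
      ∑ g, (a g * a (-k + g) + b g * b (-k + g)) := by
    rw [← Finset.sum_add_distrib]
    refine Finset.sum_congr rfl fun g _ => ?_
    rw [← even_a, ← even_b, neg_sub, sub_eq_neg_add, mul_comm, mul_comm (b _)]
  rw [circulant_mul, circulant_mul, ← circulant_add, ← circulant_single_one, ← circulant_smul]
  congr 1
  ext k
  simp only [Pi.add_apply, mulVec, dotProduct, circulant_apply, convolution, Pi.smul_apply,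
    smul_eq_mul, Pi.single_apply]
  rcases eq_or_ne k 0 with rfl | hk
  · simp [sq_a, sq_b, Finset.sum_add_distrib]
    ring
  · rw [h k hk, if_neg hk, mul_zero]

theorem isSymmetricConferencePair_circulant (even_a : a.Even) (even_b : b.Even) (zero_a : a 0 = 0)
    (sign_a : ∀ g, g ≠ 0 → a g = 1 ∨ a g = -1) (sign_b : ∀ g, b g = 1 ∨ b g = -1)
    (h : ∀ k, k ≠ 0 → ∑ g, (a g * a (-k + g) + b g * b (-k + g)) = 0) :
    IsSymmetricConferencePair (circulant a) (circulant b) where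
  symm_A := circulant_isSymm_iff.2 even_a
  symm_B := circulant_isSymm_iff.2 even_b
  diag_A i := by rw [circulant_apply, sub_self, zero_a]
  sign_A i j hij := sign_a _ (sub_ne_zero.2 hij)
  sign_B _ _ := sign_b _
  commute := circulant_mul_comm a b
  additive := circulant_sq_add_sq even_a even_b zero_a sign_a sign_b h

theorem permMatrix_neg_commute_circulant (ha : a.Even) :
    Commute ((Equiv.neg G).permMatrix ℤ) (circulant a) :=
  permMatrix_commute fun i j => by
    rw [circulant_apply, circulant_apply, Equiv.neg_apply, ← ha, neg_sub_neg, neg_sub]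

end Circulant

section Turyn

universe u

open QuadraticAlgebra

theorem quadraticChar_neg {F : Type*} [Field F] [Fintype F] [DecidableEq F]
    (h : IsSquare (-1 : F)) (x : F) : quadraticChar F (-x) = quadraticChar F x := by
  rw [← neg_one_mul, map_mul,
    (quadraticChar_one_iff_isSquare (neg_ne_zero.2 one_ne_zero)).2 h, one_mul]

variable {F : Type*} [Field F] [Fintype F] [DecidableEq F]

/-- The first function of Turyn's pair: the quadratic character of the `√d`-coordinate of an `n`-th
root of unity in `F(√d)`. The group of roots of unity is written additively, as for circulants. -/
def imChar (d : F) (n : ℕ) (g : Additive (rootsOfUnity n (QuadraticAlgebra F d 0))) : ℤ :=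
  quadraticChar F (g.toMul.1 : QuadraticAlgebra F d 0).im

/-- The second function of Turyn's pair: the quadratic character of the `F`-coordinate of an `n`-th
root of unity in `F(√d)`. -/
def reChar (d : F) (n : ℕ) (g : Additive (rootsOfUnity n (QuadraticAlgebra F d 0))) : ℤ :=
  quadraticChar F (g.toMul.1 : QuadraticAlgebra F d 0).re

variable {d : F} {n : ℕ}

theorem even_imChar (neg_one : IsSquare (-1 : F)) (hd : ¬ IsSquare d)
    (hn : 2 * n = Fintype.card F + 1) : (imChar d n).Even := fun g => by
  rw [imChar, toMul_neg, coe_inv_rootsOfUnity hd hn, im_star, quadraticChar_neg neg_one, imChar]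

theorem even_reChar (hd : ¬ IsSquare d) (hn : 2 * n = Fintype.card F + 1) :
    (reChar d n).Even := fun g => by
  rw [reChar, toMul_neg, coe_inv_rootsOfUnity hd hn, re_star, zero_mul, add_zero, reChar]

theorem isSymmetricConferencePair_imChar_reChar
    [Fintype (rootsOfUnity n (QuadraticAlgebra F d 0))] (neg_one : IsSquare (-1 : F))
    (hd : ¬ IsSquare d) (hn : 2 * n = Fintype.card F + 1) (hodd : Odd n) :
    IsSymmetricConferencePair (circulant (imChar d n)) (circulant (reChar d n)) := by
  have hd' : ¬ IsSquare (-d) := fun h => hd (by simpa using neg_one.mul h)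
  have root (g : Additive (rootsOfUnity n (QuadraticAlgebra F d 0))) :
      (g.toMul.1 : QuadraticAlgebra F d 0) ^ n = 1 := (mem_rootsOfUnity' n _).1 g.toMul.2
  refine isSymmetricConferencePair_circulant (even_imChar neg_one hd hn) (even_reChar hd hn)
    (by simp [imChar]) (fun g hg => quadraticChar_dichotomy fun him => hg ?_)
    (fun g => quadraticChar_dichotomy (re_ne_zero_of_pow_eq_one hd hodd (root g))) fun k hk => ?_
  · exact congrArg Additive.ofMul
      (Subtype.ext (Units.ext (eq_one_of_im_eq_zero hd hn hodd (root g) him)))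
  · rw [← Additive.ofMul.sum_comp]
    exact sum_quadraticChar_rootsOfUnity hd hd' hn hodd (k := k.toMul) hk

theorem exists_circulant_isSymmetricConferencePair {F : Type u} [Field F] [Fintype F]
    (hF : Fintype.card F % 4 = 1) :
    ∃ (G : Type u) (_ : AddCommGroup G) (_ : Fintype G) (_ : DecidableEq G) (a b : G → ℤ),
      2 * Fintype.card G = Fintype.card F + 1 ∧ a.Even ∧ b.Even ∧
        IsSymmetricConferencePair (circulant a) (circulant b) := by
  classical
  have char_ne_two : ringChar F ≠ 2 := fun h => by
    have := FiniteField.even_card_of_char_two h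
    omega
  have neg_one : IsSquare (-1 : F) := FiniteField.isSquare_neg_one_iff.2 (by omega)
  obtain ⟨d, hd⟩ := FiniteField.exists_nonsquare char_ne_two
  obtain ⟨n, hn⟩ : ∃ n, 2 * n = Fintype.card F + 1 := ⟨(Fintype.card F + 1) / 2, by omega⟩
  have := fact_of_not_isSquare hd
  have := Fintype.ofEquiv _ (equivProd d 0).symm
  refine ⟨Additive (rootsOfUnity n (QuadraticAlgebra F d 0)), inferInstance, inferInstance,
    inferInstance, imChar d n, reChar d n, ?_, even_imChar neg_one hd hn, even_reChar hd hn,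
    isSymmetricConferencePair_imChar_reChar neg_one hd hn (Nat.odd_iff.2 (by omega))⟩
  rw [Fintype.card_additive, ← Nat.card_eq_fintype_card, card_rootsOfUnity_quadraticAlgebra hd hn,
    hn]

end Turyn

section PaleyCore

theorem isConj_of_pow_prime_eq_one {α : Type*} [Fintype α] [DecidableEq α] {p : ℕ}
    [hp : Fact p.Prime] {σ τ : Equiv.Perm α} (hσ : σ ^ p = 1) (hτ : τ ^ p = 1)
    (h : σ.support.card = τ.support.card) : IsConj σ τ := by
  have cycleType_eq {π : Equiv.Perm α} (hπ : π ^ p = 1) :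
      π.cycleType = Multiset.replicate (π.support.card / p) p := by
    have replicate := Equiv.Perm.cycleType_of_pow_prime_eq_one hπ
    have sum := π.sum_cycleType
    rw [replicate, Multiset.sum_replicate, smul_eq_mul] at sum
    rw [replicate, ← sum, Nat.mul_div_cancel _ hp.out.pos]
  rw [Equiv.Perm.isConj_iff_cycleType_eq, cycleType_eq hσ, cycleType_eq hτ, h]

theorem neg_eq_self_iff_of_odd_card {G : Type*} [AddGroup G] (hodd : Odd (Nat.card G)) {x : G} :
    -x = x ↔ x = 0 := by
  rw [neg_eq_iff_add_eq_zero, ← two_nsmul,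
    ← (nsmulCoprime hodd.coprime_two_right).injective.eq_iff (a := x), nsmulCoprime_zero,
    nsmulCoprime_apply]

theorem exists_equiv_map_neg {G H : Type*} [AddGroup G] [AddGroup H] [Finite G] [Finite H]
    (hodd : Odd (Nat.card G)) (h : Nat.card G = Nat.card H) :
    ∃ e : G ≃ H, ∀ x, e (-x) = -e x := by
  classical
  have := Fintype.ofFinite G
  have := Fact.mk Nat.prime_two
  obtain ⟨e⟩ := Finite.card_eq.1 h
  have support_card {σ : Equiv.Perm G} {z : G} (hσ : ∀ x, σ x = x ↔ x = z) :
      σ.support.card = Fintype.card G - 1 := by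
    have support : σ.support = Finset.univ.erase z := by
      ext x
      simp [hσ]
    rw [support, Finset.card_erase_of_mem (Finset.mem_univ _), Finset.card_univ]
  have conj : IsConj (Equiv.neg G) (e.symm.permCongr (Equiv.neg H)) := by
    refine isConj_of_pow_prime_eq_one (p := 2) ?_ ?_ ?_
    · ext x
      simp [sq]
    · ext x
      simp [sq]
    · rw [support_card (z := 0) fun x => neg_eq_self_iff_of_odd_card hodd,
        support_card (z := e.symm 0) fun x => ?_]
      simp [Equiv.symm_apply_eq, Equiv.eq_symm_apply, neg_eq_self_iff_of_odd_card (h ▸ hodd)]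
  obtain ⟨c, hc⟩ := isConj_iff.1 conj
  refine ⟨c.trans e, fun x => ?_⟩
  simpa using congrArg e (Equiv.congr_fun hc (c x))

variable {F : Type*} [Field F] [Fintype F] [DecidableEq F]

theorem sum_quadraticChar_add_sq (s : F) :
    ∑ w, quadraticChar F (s + w) * quadraticChar F (s + w) = Fintype.card F - 1 := by
  have sq (w : F) : quadraticChar F (s + w) * quadraticChar F (s + w) =
      1 - if w = -s then 1 else 0 := by
    split_ifs with hw
    · simp [hw]
    · rw [← pow_two, quadraticChar_sq_one fun h => hw (eq_neg_of_add_eq_zero_right h), sub_zero]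
  simp only [sq, Finset.sum_sub_distrib]
  simp

theorem sum_quadraticChar_add_mul_of_ne (hF : ringChar F ≠ 2) {s t : F} (h : s ≠ t) :
    ∑ w, quadraticChar F (s + w) * quadraticChar F (t + w) = -1 := by
  have hst : s - t ≠ 0 := sub_ne_zero.2 h
  have bijective : Function.Bijective fun x : F => (s - t) * x - s :=
    ((Equiv.mulLeft₀ (s - t) hst).trans (Equiv.subRight s)).bijective
  have sq_sub : quadraticChar F (s - t) ^ 2 = 1 := quadraticChar_sq_one hst
  have sq_neg_one : quadraticChar F (-1) ^ 2 = 1 :=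
    quadraticChar_sq_one (neg_ne_zero.2 one_ne_zero)
  have jacobi : ∑ x, quadraticChar F x * quadraticChar F (1 - x) = -quadraticChar F (-1) := by
    simpa only [(quadraticChar_isQuadratic F).inv, jacobiSum] using
      jacobiSum_nontrivial_inv (quadraticChar_ne_one hF)
  have substitution (x : F) :
      quadraticChar F (s + ((s - t) * x - s)) * quadraticChar F (t + ((s - t) * x - s)) =
        quadraticChar F (-1) * (quadraticChar F x * quadraticChar F (1 - x)) := by
    rw [show s + ((s - t) * x - s) = (s - t) * x by ring,
      show t + ((s - t) * x - s) = -1 * ((s - t) * (1 - x)) by ring, map_mul, map_mul, map_mul]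
    linear_combination quadraticChar F (-1) * (quadraticChar F x * quadraticChar F (1 - x)) * sq_sub
  rw [← bijective.sum_comp]
  simp only [substitution, ← Finset.mul_sum, jacobi]
  linear_combination -sq_neg_one

theorem isConferenceCoreAlong_neg_quadraticChar {G : Type*} [AddGroup G] [Fintype G]
    [DecidableEq G] (hF : ringChar F ≠ 2) (e : G ≃ F) (he : ∀ x, e (-x) = -e x) :
    IsConferenceCoreAlong (Equiv.neg G) (of fun x y => quadraticChar F (e x + e y)) where
  symm := by
    ext x y
    simp only [transpose_apply, of_apply, add_comm]
  apply_perm x := by simp [he]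
  sign x y hxy := quadraticChar_dichotomy fun h => hxy
    (e.injective ((he x).trans (eq_neg_of_add_eq_zero_right h).symm))
  mul_self := by
    ext x y
    simp only [Matrix.mul_apply, Matrix.sub_apply, Matrix.smul_apply, Matrix.one_apply, of_apply,
      add_comm _ (e y)]
    rw [e.sum_comp fun w => quadraticChar F (e x + w) * quadraticChar F (e y + w),
      Fintype.card_congr e]
    rcases eq_or_ne x y with rfl | hxy
    · rw [sum_quadraticChar_add_sq, if_pos rfl, smul_eq_mul, mul_one]
    · rw [sum_quadraticChar_add_mul_of_ne hF (e.injective.ne hxy), if_neg hxy, smul_zero, zero_sub]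

theorem exists_field_card_eq {q : ℕ} (hq : IsPrimePow q) :
    ∃ (F : Type) (_ : Field F) (_ : Fintype F), Fintype.card F = q := by
  obtain ⟨f⟩ := Fintype.nonempty_field_iff.2
    (by rwa [Fintype.card_fin] : IsPrimePow (Fintype.card (Fin q)))
  exact ⟨Fin q, f, inferInstance, Fintype.card_fin q⟩

theorem exists_isConferenceCoreAlong_neg {G : Type*} [AddGroup G] [Fintype G] [DecidableEq G]
    (hodd : Odd (Fintype.card G)) (h : IsPrimePow (Fintype.card G)) :
    ∃ P, IsConferenceCoreAlong (Equiv.neg G) P := by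
  classical
  obtain ⟨F, _, _, hF⟩ := exists_field_card_eq h
  have char_ne_two : ringChar F ≠ 2 := fun h2 => by
    have := FiniteField.even_card_of_char_two h2
    grind
  obtain ⟨e, he⟩ := exists_equiv_map_neg (G := G) (H := F) (by simpa) (by simpa using hF.symm)
  exact ⟨_, isConferenceCoreAlong_neg_quadraticChar char_ne_two e he⟩

end PaleyCore

section MathonCore

/-- The label of the line through a point of the affine plane of order three, in the parallel class
attached to a nonzero residue modulo five. -/
def lineLabel (d : Fin 5) (x : Fin 3 × Fin 3) : Fin 3 :=
  ![0, x.2, x.1, x.1 - x.2, x.1 + x.2] d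

/-- The sign matrix `I + S`, where `S` is the skew core of order three, as a function of the
difference of the indices, with the sign of the residue `d` modulo five. -/
def signedSkew (d : Fin 5) (t : Fin 3) : ℤ :=
  ![0, 1, -1, -1, 1] d * ![1, 1, -1] t

/-- The block in position `(i, i + d)` of Mathon's core of order 45, with rows and columns indexed
by the points of the affine plane of order three. -/
def mathonBlock (d : Fin 5) (x y : Fin 3 × Fin 3) : ℤ :=
  if d = 0 then
    (if x = y then 0 else if x.1 = y.1 ∨ x.2 = y.2 then 1 else -1)
  else if d ≤ 2 then signedSkew d (lineLabel d x - lineLabel (-d) y)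
  else signedSkew d (lineLabel (-d) y - lineLabel d x)

theorem mathonBlock_symm : ∀ d x y, mathonBlock (-d) y x = mathonBlock d x y := by
  decide +kernel

theorem mathonBlock_sign :
    ∀ d x y, (d ≠ 0 ∨ x ≠ y) → mathonBlock d x y = 1 ∨ mathonBlock d x y = -1 := by
  decide +kernel

theorem sum_mathonBlock_mul : ∀ d x y, ∑ k, ∑ z, mathonBlock k x z * mathonBlock (k - d) y z =
    (if d = 0 ∧ x = y then 45 else 0) - 1 := by
  decide +kernel

/-- Mathon's core of order 45, which is block circulant. -/
def mathonCore : Matrix (Fin 5 × (Fin 3 × Fin 3)) (Fin 5 × (Fin 3 × Fin 3)) ℤ :=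
  of fun i j => mathonBlock (j.1 - i.1) i.2 j.2

theorem mathonCore_isSymm : mathonCore.IsSymm := by
  ext i j
  rw [transpose_apply, mathonCore, of_apply, of_apply, ← mathonBlock_symm, neg_sub]

theorem mathonCore_mul_self : mathonCore * mathonCore = (45 : ℤ) • 1 - of fun _ _ => 1 := by
  ext i j
  have hij : (j.1 - i.1 = 0 ∧ i.2 = j.2) ↔ i = j := by
    rw [sub_eq_zero, eq_comm (a := j.1), ← Prod.ext_iff]
  have row_mul_row := sum_mathonBlock_mul (j.1 - i.1) i.2 j.2
  rw [← (Equiv.subRight i.1).sum_comp] at row_mul_row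
  simp only [hij, Equiv.subRight_apply, sub_sub_sub_cancel_right] at row_mul_row
  rw [Matrix.mul_apply, Fintype.sum_prod_type, Matrix.sub_apply, Matrix.smul_apply,
    Matrix.one_apply]
  simp only [mathonCore_isSymm.apply j, smul_eq_mul, mul_ite, mul_one, mul_zero, of_apply]
  exact row_mul_row

theorem isConferenceCoreAlong_one_mathonCore : IsConferenceCoreAlong 1 mathonCore where
  symm := mathonCore_isSymm
  apply_perm i := by simp [mathonCore, mathonBlock]
  sign i j hij := mathonBlock_sign _ _ _ <| by
    by_contra! h
    exact hij (Prod.ext (sub_eq_zero.1 h.1).symm h.2)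
  mul_self := by simpa using mathonCore_mul_self

theorem exists_isSymmetricConferenceCore_45 :
    ∃ Q : Matrix (Fin 45) (Fin 45) ℤ, IsSymmetricConferenceCore Q := by
  let e : Fin 45 ≃ Fin 5 × (Fin 3 × Fin 3) := Fintype.equivOfCardEq (by simp)
  have core := isConferenceCoreAlong_one_mathonCore.submatrix e
  rw [show e.symm.permCongr 1 = 1 from Equiv.ext fun i => by simp] at core
  exact ⟨_, isSymmetricConferenceCore_iff.2 core⟩

end MathonCore

section Existence

theorem exists_isConferenceCoreAlong {G : Type*} [AddCommGroup G] [Fintype G] [DecidableEq G]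
    {n : ℕ} (hn : Fintype.card G = n) (hodd : Odd n)
    (h : IsPrimePow n ∨ ∃ Q : Matrix (Fin n) (Fin n) ℤ, IsSymmetricConferenceCore Q) :
    ∃ (σ : Equiv.Perm G) (P : Matrix G G ℤ), IsConferenceCoreAlong σ P ∧
      ∀ a : G → ℤ, a.Even → Commute (σ.permMatrix ℤ) (circulant a) := by
  subst hn
  rcases h with h | ⟨Q, hQ⟩
  · obtain ⟨P, hP⟩ := exists_isConferenceCoreAlong_neg hodd h
    exact ⟨_, P, hP, fun a => permMatrix_neg_commute_circulant⟩
  · let e := Fintype.equivFin G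
    have core := (isSymmetricConferenceCore_iff.1 hQ).submatrix e
    exact ⟨_, _, core, fun a _ => permMatrix_commute fun i j => by simp⟩

theorem exists_isSymmetricWilliamsonType_and_hadamard {q : ℕ} (hq : IsPrimePow q)
    (hq4 : q ≡ 1 [MOD 4]) (h : IsPrimePow ((q + 1) / 2) ∨
      ∃ Q : Matrix (Fin ((q + 1) / 2)) (Fin ((q + 1) / 2)) ℤ, IsSymmetricConferenceCore Q) :
    (∃ W : Fin 4 → Matrix (Fin (q + 2)) (Fin (q + 2)) ℤ, IsSymmetricWilliamsonType W) ∧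
      ∃ H : Matrix (Fin (4 * (q + 2))) (Fin (4 * (q + 2))) ℤ, IsSymmetricPropusTypeHadamard H := by
  obtain ⟨F, _, _, rfl⟩ := exists_field_card_eq hq
  obtain ⟨G, _, _, _, a, b, hG, even_a, even_b, pair⟩ :=
    exists_circulant_isSymmetricConferencePair hq4
  have hq4' : Fintype.card F % 4 = 1 := hq4
  obtain ⟨σ, P, core, commute⟩ := exists_isConferenceCoreAlong (G := G)
    (n := (Fintype.card F + 1) / 2) (by omega) (Nat.odd_iff.2 (by omega)) h
  refine (pair.isSymmetricPropus core (commute a even_a)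
    (commute b even_b)).exists_isSymmetricWilliamsonType_and_hadamard ?_
  simp only [Fintype.card_sum, Fintype.card_unit]
  omega

end Existence

end Propus

theorem mainTheorem2 :
    (∀ q : ℕ, IsPrimePow q → q ≡ 1 [MOD 4] →
      (IsPrimePow ((q + 1) / 2) ∨
        ∃ Q : Matrix (Fin ((q + 1) / 2)) (Fin ((q + 1) / 2)) ℤ,
          Propus.IsSymmetricConferenceCore Q) →
      (∃ W : Fin 4 → Matrix (Fin (q + 2)) (Fin (q + 2)) ℤ,
          Propus.IsSymmetricWilliamsonType W) ∧
        ∃ H : Matrix (Fin (4 * (q + 2))) (Fin (4 * (q + 2))) ℤ,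
          Propus.IsSymmetricPropusTypeHadamard H) ∧
    (∃ Q : Matrix (Fin 45) (Fin 45) ℤ, Propus.IsSymmetricConferenceCore Q) ∧
    (∃ H : Matrix (Fin (4 * 11)) (Fin (4 * 11)) ℤ, Propus.IsSymmetricPropusTypeHadamard H) ∧
    (∃ H : Matrix (Fin (4 * 83)) (Fin (4 * 83)) ℤ, Propus.IsSymmetricPropusTypeHadamard H) := by
  refine ⟨fun q hq hq4 h => Propus.exists_isSymmetricWilliamsonType_and_hadamard hq hq4 h,
    Propus.exists_isSymmetricConferenceCore_45, ?_, ?_⟩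
  · exact (Propus.exists_isSymmetricWilliamsonType_and_hadamard (q := 9)
      (Nat.prime_three.isPrimePow.pow two_ne_zero) rfl (.inl Nat.prime_five.isPrimePow)).2
  · exact (Propus.exists_isSymmetricWilliamsonType_and_hadamard (q := 81)
      (Nat.prime_three.isPrimePow.pow four_ne_zero) rfl
      (.inl (by norm_num : Nat.Prime 41).isPrimePow)).2
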